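/- For $t>0$ let $$f(t)=\int_0^t\frac{dx}{x}\int_0^x\frac{dy}{y}\int_0^y\frac{dz}{z}\,\bigl\{\sin x+\sin(x-y)-\sin(x-z)-\sin(x-y+z)\bigr\},$$ and for $0\le x<1$ let $$h(x)=\tfrac12\log^2(1-x)+\sum_{n=1}^\infty\frac{(1-x)^n-1}{n^2}.$$ The triple integral converges absolutely for every $t>0$; that is, the function $\frac{1}{xyz}\{\sin x+\sin(x-y)-\sin(x-z)-\sin(x-y+z)\}$ is Lebesgue integrable on $\{0<z<y<x<t\}$. The series $\sum_{n\ge1}\frac{(1-x)^n-1}{n^2}$ converges for every $x\in[0,1]$, the function $x\mapsto h(x)/x$ is in $L^1(0,1)$, and for every $t>0$ $$f(t)=\int_0^1 h(x)\,\frac{\sin(tx)}{x}\,dx.$$ Moreover $$\lim_{t\to+\infty}f(t)=\lim_{t\to+\infty}\int_0^1 h(x)\,\frac{\sin(tx)}{x}\,dx=0.$$ In particular $f(t)$ does not tend to $-\pi^3/12$ as $t\to+\infty$, which disproves the value conjectured by Silagadze. -/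

import Mathlib

open Real Set Filter Topology MeasureTheory

noncomputable section

/-- The trigonometric kernel `sin x + sin (x - y) - sin (x - z) - sin (x - y + z)`. -/
def tripleKernel (x y z : ℝ) : ℝ :=
  sin x + sin (x - y) - sin (x - z) - sin (x - y + z)

/-- The iterated integral
`f t = ∫_0^t dx/x ∫_0^x dy/y ∫_0^y dz/z {sin x + sin(x-y) - sin(x-z) - sin(x-y+z)}`. -/
def tripleIntegral (t : ℝ) : ℝ :=
  ∫ x in (0 : ℝ)..t, (1 / x) *
    ∫ y in (0 : ℝ)..x, (1 / y) *
      ∫ z in (0 : ℝ)..y, (1 / z) * tripleKernel x y z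

/-- The `n`-th term, counted from `n = 0`, of the series `∑_{m ≥ 1} ((1 - x)^m - 1) / m^2`. -/
def seriesTerm (x : ℝ) (n : ℕ) : ℝ :=
  ((1 - x) ^ (n + 1) - 1) / ((n : ℝ) + 1) ^ 2

/-- The function `(1/2) log^2 (1 - x) + ∑_{n ≥ 1} ((1 - x)^n - 1) / n^2`. -/
def fourierWeight (x : ℝ) : ℝ :=
  (1 / 2) * (log (1 - x)) ^ 2 + ∑' n : ℕ, seriesTerm x n

end

/-! Each integration replaces a difference of sines by an integral of a cosine and swaps the order
of integration, so that the singular factors `1/z`, `1/y`, `1/x` cancel in turn. With `L(r) = log((1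
- r)/r)`, the `z`-integral is `y ∫₀¹ cos(x - y r) L(r) dr` (`tripleKernel_integral_z`). The
`y`-integral then brings in the tail `∫_r^1 L(v)/v dv = h(1 - r)` and equals `x ∫₀¹ cos(x u) h(u)
du` (`tripleKernel_integral_yz`). Integrating `cos(x u)` over `0 < x < t` gives `sin(t u)/u`, which
is the sine formula.

Near `0` the function `h(x)/x` is `O(x^(-1/2))`, and near `1` it has only a squared logarithm, so it
is integrable. The Riemann–Lebesgue lemma gives the limit `0`. Absolute convergence is proved
separately, by a product bound; the swaps above do not rely on it. -/

/-! ### Tools: the Riemann–Lebesgue lemma and two forms of Fubini's theorem. -/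

/-- The Riemann–Lebesgue lemma for the sine transform over an interval. -/
theorem tendsto_integral_mul_sin {f : ℝ → ℝ} (hf : IntervalIntegrable f volume 0 1) :
    Tendsto (fun t : ℝ => ∫ x in (0 : ℝ)..1, f x * sin (t * x)) atTop (𝓝 0) := by
  rw [intervalIntegrable_iff_integrableOn_Ioc_of_le zero_le_one] at hf
  set F : ℝ → ℂ := fun x => (((Ioc (0 : ℝ) 1).indicator f x : ℝ) : ℂ) with hF
  have hFi : Integrable F := (hf.integrable_indicator measurableSet_Ioc).ofReal
  -- The character is `e^(2πi·)` evaluated at a negative argument, hence the frequency `t/(2π)` and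
  -- the minus sign before the imaginary part.
  have key : ∀ t : ℝ, ∫ x in (0 : ℝ)..1, f x * sin (t * x) =
      -(∫ v : ℝ, Real.fourierChar (-(v * (t * (2 * π)⁻¹))) • F v).im := by
    intro t
    have h1 : Integrable (fun v : ℝ => Real.fourierChar (-(v * (t * (2 * π)⁻¹))) • F v) := by
      have := (Real.fourierIntegral_convergent_iff (μ := volume) (f := F)
        (t * (2 * π)⁻¹ : ℝ)).2 hFi
      simpa [mul_comm] using this
    have h2 := integral_im h1
    simp only [RCLike.im_to_complex] at h2
    rw [← h2, ← integral_neg, intervalIntegral.integral_of_le zero_le_one,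
      ← integral_indicator measurableSet_Ioc]
    congr 1
    ext v
    have hv : 2 * π * -(v * (t * (2 * π)⁻¹)) = -(t * v) := by field_simp
    rw [Circle.smul_def, Real.fourierChar_apply, hv]
    by_cases h : v ∈ Ioc (0 : ℝ) 1
    · simp only [hF, indicator_of_mem h, smul_eq_mul, Complex.im_mul_ofReal,
        Complex.exp_ofReal_mul_I_im, sin_neg]
      ring
    · simp [hF, indicator_of_notMem h]
  have h3 : Tendsto (fun t : ℝ => t * (2 * π)⁻¹) atTop (cocompact ℝ) :=
    (tendsto_id.atTop_mul_const (by positivity)).mono_right atTop_le_cocompact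
  have h4 := (Real.tendsto_integral_exp_smul_cocompact F).comp h3
  have h5 := ((Complex.continuous_im.tendsto 0).comp h4).neg
  simpa [Function.comp_def, key] using h5

/-- Fubini's theorem on a triangle, for a weight that may be singular at its vertex `0`. -/
theorem triangle_fubini {φ g : ℝ → ℝ} {C : ℝ} (hφm : Measurable φ)
    (hφ : IntervalIntegrable (fun v => v * φ v) volume 0 1) (hg : Continuous g)
    (hC : ∀ r, |g r| ≤ C) :
    IntervalIntegrable (fun r => g r * ∫ v in r..1, φ v) volume 0 1 ∧
    ∫ v in (0 : ℝ)..1, φ v * ∫ r in (0 : ℝ)..v, g r =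
      ∫ r in (0 : ℝ)..1, g r * ∫ v in r..1, φ v := by
  set F : ℝ → ℝ → ℝ := fun v r => (Iic v).indicator (fun r => φ v * g r) r with hF
  have hmeas : Measurable (Function.uncurry F) := by
    have : Function.uncurry F =
        {p : ℝ × ℝ | p.2 ≤ p.1}.indicator fun p => φ p.1 * g p.2 := by
      ext ⟨v, r⟩
      by_cases h : r ≤ v <;> simp [hF, Function.uncurry, h]
    rw [this]
    refine Measurable.indicator ?_ (measurableSet_le measurable_snd measurable_fst)
    exact (hφm.comp measurable_fst).mul (hg.measurable.comp measurable_snd)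
  have hbound : ∀ v r, ‖F v r‖ ≤ |φ v| * C := by
    intro v r
    refine (norm_indicator_le_norm_self _ _).trans ?_
    rw [norm_mul]
    exact mul_le_mul_of_nonneg_left (hC r) (abs_nonneg _)
  have hinner : ∀ v, IntegrableOn (F v) (Ioc 0 1) := fun v =>
    Measure.integrableOn_of_bounded (M := |φ v| * C) (by simp)
      (hmeas.comp measurable_prodMk_left).aestronglyMeasurable (ae_of_all _ (hbound v))
  have hv : ∀ v ∈ Ioc (0 : ℝ) 1, ∀ k : ℝ → ℝ,
      ∫ r in Ioc (0 : ℝ) 1, (Iic v).indicator k r = ∫ r in (0 : ℝ)..v, k r := by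
    intro v hv k
    rw [integral_indicator measurableSet_Iic, Measure.restrict_restrict measurableSet_Iic,
      intervalIntegral.integral_of_le hv.1.le, Iic_inter_Ioc_of_le hv.2]
  have hr : ∀ r ∈ Ioc (0 : ℝ) 1, ∫ v in Ioc (0 : ℝ) 1, F v r = g r * ∫ v in r..1, φ v := by
    intro r hr
    have : (fun v => F v r) = (Ici r).indicator fun v => g r * φ v := by
      ext v
      by_cases h : r ≤ v <;> simp [hF, h, mul_comm]
    rw [this, integral_indicator measurableSet_Ici, Measure.restrict_restrict measurableSet_Ici,
      intervalIntegral.integral_of_le hr.2, integral_const_mul]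
    congr 1
    rw [← integral_Icc_eq_integral_Ioc]
    congr 2
    ext v
    simp only [mem_inter_iff, mem_Ici, mem_Ioc, mem_Icc]
    exact ⟨fun h => ⟨h.1, h.2.2⟩, fun h => ⟨h.1, hr.1.trans_le h.1, h.2⟩⟩
  have hint : Integrable (Function.uncurry F)
      ((volume.restrict (Ioc 0 1)).prod (volume.restrict (Ioc 0 1))) := by
    rw [integrable_prod_iff hmeas.aestronglyMeasurable]
    refine ⟨ae_of_all _ hinner, ?_⟩
    rw [intervalIntegrable_iff_integrableOn_Ioc_of_le zero_le_one] at hφ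
    refine (hφ.norm.mul_const C).mono'
      hmeas.norm.aestronglyMeasurable.integral_prod_right' ?_
    filter_upwards [ae_restrict_mem measurableSet_Ioc] with v hv'
    rw [Real.norm_of_nonneg (integral_nonneg fun _ => norm_nonneg _)]
    simp only [Function.uncurry, hF, norm_indicator_eq_indicator_norm]
    rw [hv v hv']
    have := intervalIntegral.norm_integral_le_of_norm_le_const (a := 0) (b := v)
      (f := fun r => ‖φ v * g r‖) (C := |φ v| * C) (fun r _ => by
        rw [norm_norm, norm_mul]
        exact mul_le_mul_of_nonneg_left (hC r) (abs_nonneg _))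
    refine (le_abs_self _).trans (this.trans (le_of_eq ?_))
    rw [sub_zero, norm_mul, Real.norm_eq_abs, Real.norm_eq_abs, abs_of_pos hv'.1]
    ring
  constructor
  · rw [intervalIntegrable_iff_integrableOn_Ioc_of_le zero_le_one]
    refine hint.integral_prod_right.congr ?_
    filter_upwards [ae_restrict_mem measurableSet_Ioc] with r hr'
    exact hr r hr'
  · rw [intervalIntegral.integral_of_le zero_le_one, intervalIntegral.integral_of_le zero_le_one,
      ← setIntegral_congr_fun measurableSet_Ioc hr, ← integral_integral_swap hint]
    refine setIntegral_congr_fun measurableSet_Ioc fun v hv' => ?_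
    simp only [hF, hv v hv', intervalIntegral.integral_const_mul]

/-- Fubini's theorem on a rectangle for a bounded continuous kernel and an integrable weight. -/
theorem rectangle_fubini {h : ℝ → ℝ} {c : ℝ → ℝ → ℝ} {C : ℝ} (t : ℝ)
    (hh : IntervalIntegrable h volume 0 1) (hc : Continuous (Function.uncurry c))
    (hC : ∀ x u, |c x u| ≤ C) :
    ∫ x in (0 : ℝ)..t, ∫ u in (0 : ℝ)..1, c x u * h u =
      ∫ u in (0 : ℝ)..1, (∫ x in (0 : ℝ)..t, c x u) * h u := by
  rw [intervalIntegral_intervalIntegral_swap]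
  · simp only [intervalIntegral.integral_mul_const]
  · rw [intervalIntegrable_iff] at hh
    rw [IntegrableOn, Measure.volume_eq_prod, ← Measure.prod_restrict]
    have h1 : Integrable (fun _ : ℝ => (1 : ℝ)) (volume.restrict (uIoc 0 t)) :=
      intervalIntegrable_iff.1 (continuous_const.intervalIntegrable 0 t)
    refine ((h1.mul_prod hh).bdd_mul (f := Function.uncurry c) (c := C)
      hc.aestronglyMeasurable (ae_of_all _ fun p => hC p.1 p.2)).congr (ae_of_all _ fun p => ?_)
    simp [Function.uncurry]

/-! ### The logarithmic weight and its tail integral. -/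

/-- The logarithmic weight `log ((1 - v) / v)` on `(0, 1)`. -/
noncomputable def logRatio (v : ℝ) : ℝ := log (1 - v) - log v

theorem measurable_logRatio : Measurable logRatio := by
  unfold logRatio; fun_prop

theorem intervalIntegrable_log_one_sub (a b : ℝ) :
    IntervalIntegrable (fun v : ℝ => log (1 - v)) volume a b := by
  have := (intervalIntegral.intervalIntegrable_log' (a := 1 - a) (b := 1 - b)).comp_sub_left 1
  simpa using this

theorem intervalIntegrable_logRatio (a b : ℝ) : IntervalIntegrable logRatio volume a b :=
  (intervalIntegrable_log_one_sub a b).sub intervalIntegral.intervalIntegrable_log'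

theorem integral_neg_log_div {r : ℝ} (hr : 0 < r) :
    IntervalIntegrable (fun v => -log v / v) volume r 1 ∧
    ∫ v in r..1, -log v / v = 1 / 2 * log r ^ 2 := by
  have hpos : ∀ v ∈ uIcc r 1, 0 < v := fun v hv => (lt_min hr one_pos).trans_le hv.1
  have hi : IntervalIntegrable (fun v => -log v / v) volume r 1 :=
    ContinuousOn.intervalIntegrable fun v hv => by
      have := (hpos v hv).ne'
      exact ContinuousAt.continuousWithinAt (by fun_prop (disch := assumption))
  refine ⟨hi, ?_⟩
  rw [intervalIntegral.integral_eq_sub_of_hasDerivAt (f := fun v => -(1 / 2) * log v ^ 2) _ hi]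
  · simp
  · intro v hv
    convert! ((hasDerivAt_log (hpos v hv).ne').pow 2).const_mul (-(1 / 2 : ℝ)) using 1
    simp; ring

theorem summable_one_div_succ_sq : Summable fun n : ℕ => 1 / ((n : ℝ) + 1) ^ 2 := by
  have := (summable_nat_add_iff 1).2 (Real.summable_one_div_nat_pow.2 one_lt_two)
  simpa using this

theorem intervalIntegrable_log_one_sub_div {r : ℝ} (hr : 0 < r) :
    IntervalIntegrable (fun v => log (1 - v) / v) volume r 1 := by
  simp only [div_eq_mul_inv]
  refine (intervalIntegrable_log_one_sub r 1).mul_continuousOn fun v hv => ?_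
  exact (continuousAt_inv₀ ((lt_min hr one_pos).trans_le hv.1).ne').continuousWithinAt

/-- Expand `log(1 - v)/v = -∑ v^n/(n+1)` and integrate termwise; the integrals of the nonnegative
terms are dominated by `1/(n+1)^2`. -/
theorem integral_log_one_sub_div {r : ℝ} (hr : 0 < r) (hr1 : r ≤ 1) :
    ∫ v in r..1, log (1 - v) / v = ∑' n : ℕ, seriesTerm (1 - r) n := by
  have hterm : ∀ n : ℕ, ∫ v in Ioo r 1, v ^ n / ((n : ℝ) + 1) =
      (1 - r ^ (n + 1)) / ((n : ℝ) + 1) ^ 2 := by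
    intro n
    rw [← integral_Ioc_eq_integral_Ioo, ← intervalIntegral.integral_of_le hr1,
      intervalIntegral.integral_div, integral_pow, one_pow, div_div, sq]
  have hnorm : ∀ n : ℕ, ∫ v in Ioo r 1, ‖v ^ n / ((n : ℝ) + 1)‖ =
      (1 - r ^ (n + 1)) / ((n : ℝ) + 1) ^ 2 := by
    intro n
    rw [← hterm n]
    refine setIntegral_congr_fun measurableSet_Ioo fun v hv => Real.norm_of_nonneg ?_
    have := hr.trans hv.1
    positivity
  have hsum : Summable fun n : ℕ => (1 - r ^ (n + 1)) / ((n : ℝ) + 1) ^ 2 := by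
    refine Summable.of_nonneg_of_le (fun n => ?_) (fun n => ?_) summable_one_div_succ_sq
    · have := pow_le_one₀ (n := n + 1) hr.le hr1
      exact div_nonneg (by linarith) (by positivity)
    · have := pow_nonneg hr.le (n + 1)
      gcongr
      linarith
  have hint : ∀ n : ℕ, Integrable (fun v : ℝ => v ^ n / ((n : ℝ) + 1))
      (volume.restrict (Ioo r 1)) := fun n =>
    ((Continuous.integrableOn_Icc (by fun_prop)).mono_set Ioo_subset_Icc_self)
  have h := integral_tsum_of_summable_integral_norm hint (by simpa only [hnorm] using hsum)
  -- The endpoint `v = 1`, where the logarithm series diverges, is dropped.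
  rw [intervalIntegral.integral_of_le hr1, integral_Ioc_eq_integral_Ioo]
  have h2 : ∫ v in Ioo r 1, log (1 - v) / v =
      ∫ v in Ioo r 1, -∑' n : ℕ, v ^ n / ((n : ℝ) + 1) := by
    refine setIntegral_congr_fun measurableSet_Ioo fun v hv => ?_
    have hv0 : 0 < v := hr.trans hv.1
    have := (hasSum_pow_div_log_of_abs_lt_one
      (x := v) (by rw [abs_of_pos hv0]; exact hv.2)).div_const v
    have h3 : (fun n : ℕ => v ^ (n + 1) / ((n : ℝ) + 1) / v) =
        fun n : ℕ => v ^ n / ((n : ℝ) + 1) := by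
      ext n; rw [pow_succ]; field_simp
    rw [h3] at this
    simp only [this.tsum_eq]
    ring
  rw [h2, integral_neg, ← h, ← tsum_neg]
  congr 1
  ext n
  rw [hterm, seriesTerm]
  ring

/-- The Fourier weight is a primitive of `log ((1 - v) / v) / v`. -/
theorem integral_logRatio_div {r : ℝ} (hr : 0 < r) (hr1 : r ≤ 1) :
    ∫ v in r..1, logRatio v / v = fourierWeight (1 - r) := by
  obtain ⟨hi, he⟩ := integral_neg_log_div hr
  have : (fun v => logRatio v / v) = fun v => -log v / v + log (1 - v) / v := by
    ext v; rw [logRatio]; ring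
  rw [this, intervalIntegral.integral_add hi (intervalIntegrable_log_one_sub_div hr), he,
    integral_log_one_sub_div hr hr1, fourierWeight, sub_sub_cancel]

/-! ### Integrability of `h(x)/x`. -/

theorem abs_seriesTerm_le {x : ℝ} (hx : x ∈ Icc (0 : ℝ) 1) (n : ℕ) :
    |seriesTerm x n| ≤ 1 / ((n : ℝ) + 1) ^ 2 := by
  have h0 : 0 ≤ 1 - x := by linarith [hx.2]
  have h1 : 1 - x ≤ 1 := by linarith [hx.1]
  rw [seriesTerm, abs_div, abs_of_nonneg (by positivity : (0 : ℝ) ≤ ((n : ℝ) + 1) ^ 2)]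
  gcongr
  rw [abs_le]
  constructor <;> linarith [pow_nonneg h0 (n + 1), pow_le_one₀ (n := n + 1) h0 h1]

theorem summable_seriesTerm {x : ℝ} (hx : x ∈ Icc (0 : ℝ) 1) : Summable (seriesTerm x) :=
  Summable.of_norm_bounded summable_one_div_succ_sq (abs_seriesTerm_le hx)

/-- With `N = n + 1`, Bernoulli gives `1 - (1 - x)^N ≤ min(1, N x) ≤ √(N x)`. The exponent `1/2` is
a compromise: the remaining `N^(-3/2)` is summable, and `√x / x` is integrable at `0`. -/
theorem abs_seriesTerm_le_sqrt {x : ℝ} (hx : x ∈ Icc (0 : ℝ) 1) (n : ℕ) :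
    |seriesTerm x n| ≤ x ^ (1 / 2 : ℝ) * (1 / ((n + 1 : ℕ) : ℝ) ^ (3 / 2 : ℝ)) := by
  have h0 : 0 ≤ 1 - x := by linarith [hx.2]
  have h1 : 1 - x ≤ 1 := by linarith [hx.1]
  have hp := pow_nonneg h0 (n + 1)
  have hp1 := pow_le_one₀ (n := n + 1) h0 h1
  have hb := one_add_mul_le_pow (a := -x) (by linarith [hx.2]) (n + 1)
  set N : ℝ := ((n + 1 : ℕ) : ℝ) with hN
  have hNpos : 0 < N := by rw [hN]; positivity
  have key : 1 - (1 - x) ^ (n + 1) ≤ x ^ (1 / 2 : ℝ) * N ^ (1 / 2 : ℝ) := by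
    rw [← mul_rpow hx.1 hNpos.le, ← sqrt_eq_rpow]
    refine Real.le_sqrt_of_sq_le ?_
    rw [← sub_eq_add_neg] at hb
    nlinarith
  have hN2 : N ^ 2 = N ^ (1 / 2 : ℝ) * N ^ (3 / 2 : ℝ) := by
    rw [← rpow_add hNpos]; norm_num
  have hNe : (n : ℝ) + 1 = N := by rw [hN]; push_cast; ring
  rw [seriesTerm, hNe, abs_div, abs_of_nonpos (by linarith), abs_of_pos (pow_pos hNpos 2), hN2]
  have hA : 0 < N ^ (1 / 2 : ℝ) := rpow_pos_of_pos hNpos _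
  have hB : 0 < N ^ (3 / 2 : ℝ) := rpow_pos_of_pos hNpos _
  rw [mul_one_div, div_le_div_iff₀ (by positivity) hB]
  nlinarith

theorem exists_abs_tsum_seriesTerm_le : ∃ C : ℝ, ∀ x ∈ Icc (0 : ℝ) 1,
    |∑' n : ℕ, seriesTerm x n| ≤ C * x ^ (1 / 2 : ℝ) := by
  have hs : Summable fun n : ℕ => 1 / ((n + 1 : ℕ) : ℝ) ^ (3 / 2 : ℝ) :=
    (summable_nat_add_iff 1).2 (Real.summable_one_div_nat_rpow.2 (by norm_num))
  refine ⟨∑' n : ℕ, 1 / ((n + 1 : ℕ) : ℝ) ^ (3 / 2 : ℝ), fun x hx => ?_⟩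
  rw [mul_comm, ← tsum_mul_left]
  exact tsum_of_norm_bounded (f := seriesTerm x) (hs.mul_left _).hasSum
    (abs_seriesTerm_le_sqrt hx)

/-- Apply `log u ≤ u - 1` to `u = s^(-1/4)`. The factor `1 - s` records the zero at `s = 1`, and the
exponent is small enough that the square, `s^(-1/2)`, is still integrable at `0`. -/
theorem neg_log_le {s : ℝ} (hs : 0 < s) (hs1 : s ≤ 1) :
    -log s ≤ 4 * (s ^ (-(1 / 4) : ℝ) * (1 - s)) := by
  have h1 := log_le_sub_one_of_pos (rpow_pos_of_pos hs (-(1 / 4) : ℝ))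
  rw [log_rpow hs] at h1
  have h2 : s ^ (-(1 / 4) : ℝ) * s ≤ 1 := by
    nth_rewrite 2 [← rpow_one s]
    rw [← rpow_add hs]
    exact rpow_le_one hs.le hs1 (by norm_num)
  linarith

theorem abs_log_sq_div_le {x : ℝ} (hx : x ∈ Ioo (0 : ℝ) 1) :
    |1 / 2 * log (1 - x) ^ 2 / x| ≤ 8 * (1 - x) ^ (-(1 / 2) : ℝ) := by
  have hs : 0 < 1 - x := by linarith [hx.2]
  have h := neg_log_le hs (by linarith [hx.1])
  have hl : log (1 - x) ≤ 0 := log_nonpos hs.le (by linarith [hx.1])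
  have h2 := pow_le_pow_left₀ (by linarith) h 2
  have h3 : ((1 - x) ^ (-(1 / 4) : ℝ)) ^ 2 = (1 - x) ^ (-(1 / 2) : ℝ) := by
    rw [← rpow_natCast, ← rpow_mul hs.le]; norm_num
  have hA : 0 < (1 - x) ^ (-(1 / 2) : ℝ) := rpow_pos_of_pos hs _
  rw [mul_pow, mul_pow, h3, sub_sub_cancel] at h2
  have hx0 := hx.1
  rw [abs_of_nonneg (by positivity), div_le_iff₀ hx0]
  have h4 : (1 - x) ^ (-(1 / 2) : ℝ) * x ^ 2 ≤ (1 - x) ^ (-(1 / 2) : ℝ) * x :=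
    mul_le_mul_of_nonneg_left (by nlinarith [hx.2]) hA.le
  nlinarith

theorem integrableOn_fourierWeight_div :
    IntegrableOn (fun x : ℝ => fourierWeight x / x) (Ioo 0 1) := by
  obtain ⟨C, hC⟩ := exists_abs_tsum_seriesTerm_le
  have hsplit : (fun x : ℝ => fourierWeight x / x) = fun x =>
      1 / 2 * log (1 - x) ^ 2 / x + (∑' n : ℕ, seriesTerm x n) / x := by
    ext x; rw [fourierWeight, add_div]
  rw [hsplit]
  have hI : IntegrableOn (fun x : ℝ => x ^ (-(1 / 2) : ℝ)) (Ioo 0 1) := by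
    rw [← integrableOn_Ioc_iff_integrableOn_Ioo,
      ← intervalIntegrable_iff_integrableOn_Ioc_of_le zero_le_one]
    exact intervalIntegral.intervalIntegrable_rpow' (by norm_num)
  have hI' : IntegrableOn (fun x : ℝ => (1 - x) ^ (-(1 / 2) : ℝ)) (Ioo 0 1) := by
    rw [← integrableOn_Ioc_iff_integrableOn_Ioo,
      ← intervalIntegrable_iff_integrableOn_Ioc_of_le zero_le_one]
    have := (intervalIntegral.intervalIntegrable_rpow' (a := 1) (b := 0)
      (r := -(1 / 2)) (by norm_num)).comp_sub_left 1
    simpa using this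
  refine Integrable.add ?_ ?_
  · refine (Integrable.const_mul hI' 8).mono'
      (Measurable.aestronglyMeasurable (by fun_prop)) ?_
    filter_upwards [ae_restrict_mem measurableSet_Ioo] with x hx
    exact abs_log_sq_div_le hx
  · have hcont : ContinuousOn (fun x => ∑' n : ℕ, seriesTerm x n) (Ioo 0 1) :=
      continuousOn_tsum (fun n => by unfold seriesTerm; fun_prop) summable_one_div_succ_sq
        fun n x hx => abs_seriesTerm_le (Ioo_subset_Icc_self hx) n
    refine (Integrable.const_mul hI C).mono' ((hcont.div continuousOn_id
      fun x hx => hx.1.ne').aestronglyMeasurable measurableSet_Ioo) ?_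
    filter_upwards [ae_restrict_mem measurableSet_Ioo] with x hx
    have h := hC x (Ioo_subset_Icc_self hx)
    rw [Real.norm_eq_abs, abs_div, abs_of_pos hx.1, div_le_iff₀ hx.1, mul_assoc]
    have : x ^ (-(1 / 2) : ℝ) * x = x ^ (1 / 2 : ℝ) := by
      nth_rewrite 2 [← rpow_one x]
      rw [← rpow_add hx.1]; norm_num
    rwa [this]

/-! ### Reduction of the triple integral to a sine integral. -/

theorem integral_cos_sub_mul {c : ℝ} (hc : c ≠ 0) (x v : ℝ) :
    ∫ r in (0 : ℝ)..v, c * cos (x - c * r) = sin x - sin (x - c * v) := by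
  rw [intervalIntegral.integral_const_mul, intervalIntegral.integral_comp_sub_mul cos hc,
    integral_cos, mul_zero, sub_zero, smul_eq_mul, mul_inv_cancel_left₀ hc]

/-- The kernel vanishes at `z = 0`; after `z = y v` it is the primitive of a bounded function `g`.
Swapping on the triangle turns the weight `1/v` into `-log r`. -/
theorem tripleKernel_integral_z (x : ℝ) {y : ℝ} (hy : 0 < y) :
    ∫ z in (0 : ℝ)..y, (1 / z) * tripleKernel x y z =
      y * ∫ r in (0 : ℝ)..1, cos (x - y * r) * logRatio r := by
  -- The form `- -y * r` lets `integral_cos_sub_mul` apply to the second cosine with constant `-y`.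
  set g : ℝ → ℝ := fun r => y * cos (x - y * r) - y * cos ((x - y) - -y * r) with hg
  have hgc : Continuous g := by fun_prop
  have hgb : ∀ r, |g r| ≤ y + y := fun r => by
    refine (abs_sub _ _).trans (add_le_add ?_ ?_) <;>
    · rw [abs_mul, abs_of_pos hy]
      exact mul_le_of_le_one_right hy.le (abs_cos_le_one _)
  have hgi : ∀ v, ∫ r in (0 : ℝ)..v, g r = tripleKernel x y (y * v) := fun v => by
    have h2 : ∀ r, y * cos ((x - y) - -y * r) = -(-y * cos ((x - y) - -y * r)) := fun r => by ring
    rw [hg, intervalIntegral.integral_sub (Continuous.intervalIntegrable (by fun_prop) _ _)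
      (Continuous.intervalIntegrable (by fun_prop) _ _), integral_cos_sub_mul hy.ne']
    simp only [h2]
    rw [intervalIntegral.integral_neg, integral_cos_sub_mul (neg_ne_zero.2 hy.ne'), tripleKernel]
    rw [show x - y - -y * v = x - y + y * v by ring]
    ring
  have hφ : IntervalIntegrable (fun v : ℝ => v * (1 / v)) volume 0 1 := by
    refine (intervalIntegrable_const (c := (1 : ℝ))).congr fun v hv => ?_
    rw [uIoc_of_le zero_le_one] at hv
    exact (mul_one_div_cancel hv.1.ne').symm
  have hF := (triangle_fubini (φ := fun v => 1 / v) (by fun_prop) hφ hgc hgb).2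
  have hlog : ∀ r ∈ Ioc (0 : ℝ) 1, g r * ∫ v in r..1, 1 / v = g r * -log r := fun r hr => by
    rw [integral_one_div_of_pos hr.1 one_pos, one_div, log_inv]
  have hscale : ∫ z in (0 : ℝ)..y, (1 / z) * tripleKernel x y z =
      ∫ v in (0 : ℝ)..1, 1 / v * tripleKernel x y (y * v) := by
    have h := intervalIntegral.integral_comp_mul_left (a := 0) (b := 1)
      (fun z => (1 / z) * tripleKernel x y z) hy.ne'
    rw [mul_zero, mul_one, smul_eq_mul] at h
    rw [eq_inv_mul_iff_mul_eq₀ hy.ne'] at h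
    rw [← h, ← intervalIntegral.integral_const_mul]
    congr 1
    ext v
    field_simp
  simp only [hgi] at hF
  rw [hscale, hF, intervalIntegral.integral_of_le zero_le_one,
    setIntegral_congr_fun measurableSet_Ioc hlog, ← intervalIntegral.integral_of_le zero_le_one]
  have hl : IntervalIntegrable (fun r => -log r) volume 0 1 :=
    intervalIntegral.intervalIntegrable_log'.neg
  have hl1 : IntervalIntegrable (fun r => -log (1 - r)) volume 0 1 :=
    (intervalIntegrable_log_one_sub 0 1).neg
  have hc1 : Continuous fun r => y * cos (x - y * r) := by fun_prop
  have hc2 : Continuous fun r => y * cos ((x - y) - -y * r) := by fun_prop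
  -- The reflection `r ↦ 1 - r` gives both halves the same cosine, so their logarithms combine into
  -- `logRatio`.
  have hsub : ∫ r in (0 : ℝ)..1, y * cos ((x - y) - -y * r) * -log r =
      ∫ r in (0 : ℝ)..1, y * cos (x - y * r) * -log (1 - r) := by
    have h := intervalIntegral.integral_comp_sub_left (a := 0) (b := 1)
      (fun r => y * cos (x - y * r) * -log (1 - r)) 1
    rw [sub_self, sub_zero] at h
    rw [← h]
    congr 1
    ext r
    rw [sub_sub_cancel, show x - y * (1 - r) = x - y - -y * r by ring]
  have h3 : ∀ r, g r * -log r =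
      y * cos (x - y * r) * -log r - y * cos ((x - y) - -y * r) * -log r := fun r => by
    rw [hg]; ring
  simp only [h3]
  rw [intervalIntegral.integral_sub (hl.continuousOn_mul hc1.continuousOn)
    (hl.continuousOn_mul hc2.continuousOn), hsub,
    ← intervalIntegral.integral_sub (hl.continuousOn_mul hc1.continuousOn)
    (hl1.continuousOn_mul hc1.continuousOn), ← intervalIntegral.integral_const_mul]
  congr 1
  ext r
  rw [logRatio]; ring

theorem intervalIntegrable_mul_logRatio_div :
    IntervalIntegrable (fun v : ℝ => v * (logRatio v / v)) volume 0 1 := by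
  refine (intervalIntegrable_logRatio 0 1).congr fun v hv => ?_
  rw [uIoc_of_le zero_le_one] at hv
  exact (mul_div_cancel₀ _ hv.1.ne').symm

theorem intervalIntegrable_fourierWeight : IntervalIntegrable fourierWeight volume 0 1 := by
  rw [intervalIntegrable_iff_integrableOn_Ioc_of_le zero_le_one,
    integrableOn_Ioc_iff_integrableOn_Ioo]
  have h := integrableOn_fourierWeight_div.bdd_mul (f := fun x : ℝ => x) (c := 1)
    (by fun_prop) (by
      filter_upwards [ae_restrict_mem measurableSet_Ioo] with x hx
      rw [Real.norm_of_nonneg hx.1.le]; exact hx.2.le)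
  refine h.congr ?_
  filter_upwards [ae_restrict_mem measurableSet_Ioo] with x hx
  exact mul_div_cancel₀ _ hx.1.ne'

theorem tripleKernel_integral_yz {x : ℝ} (hx : 0 < x) :
    ∫ y in (0 : ℝ)..x, (1 / y) * ∫ z in (0 : ℝ)..y, (1 / z) * tripleKernel x y z =
      x * ∫ u in (0 : ℝ)..1, cos (x * u) * fourierWeight u := by
  have h1 : ∀ y ∈ Ioc (0 : ℝ) x, (1 / y) * ∫ z in (0 : ℝ)..y, (1 / z) * tripleKernel x y z =
      ∫ r in (0 : ℝ)..1, cos (x - y * r) * logRatio r := fun y hy => by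
    rw [tripleKernel_integral_z x hy.1, ← mul_assoc, one_div_mul_cancel hy.1.ne', one_mul]
  rw [intervalIntegral.integral_of_le hx.le, setIntegral_congr_fun measurableSet_Ioc h1,
    ← intervalIntegral.integral_of_le hx.le,
    rectangle_fubini (C := 1) x (intervalIntegrable_logRatio 0 1)
      (c := fun y r => cos (x - y * r)) (by unfold Function.uncurry; fun_prop)
      (fun _ _ => abs_cos_le_one _)]
  -- The difference `sin x - sin(x - x r)` is read in two ways: as an integral over `(0, x)` with
  -- slope `r`, and over `(0, r)` with slope `x`. The second reading puts the integral on a triangle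
  -- with weight `logRatio v / v`.
  have h2 : ∀ r ∈ Ioc (0 : ℝ) 1, (∫ y in (0 : ℝ)..x, cos (x - y * r)) * logRatio r =
      logRatio r / r * ∫ w in (0 : ℝ)..r, x * cos (x - x * w) := fun r hr => by
    have h := integral_cos_sub_mul hr.1.ne' x x
    rw [intervalIntegral.integral_const_mul] at h
    rw [integral_cos_sub_mul hx.ne', mul_comm x r, ← h]
    simp only [mul_comm _ r]
    have := hr.1.ne'
    field_simp
  rw [intervalIntegral.integral_of_le zero_le_one, setIntegral_congr_fun measurableSet_Ioc h2,
    ← intervalIntegral.integral_of_le zero_le_one,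
    (triangle_fubini (C := x) (φ := fun v => logRatio v / v) (measurable_logRatio.div measurable_id)
      intervalIntegrable_mul_logRatio_div (by fun_prop) fun r => by
        rw [abs_mul, abs_of_pos hx]
        exact mul_le_of_le_one_right hx.le (abs_cos_le_one _)).2]
  -- The tail is the Fourier weight at `1 - r`, and `u = 1 - r` also simplifies the phase `x - x r`
  -- to `x u`.
  have h3 : ∀ r ∈ Ioc (0 : ℝ) 1, x * cos (x - x * r) * ∫ v in r..1, logRatio v / v =
      x * cos (x * (1 - r)) * fourierWeight (1 - r) := fun r hr => by
    rw [integral_logRatio_div hr.1 hr.2, mul_sub, mul_one]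
  rw [intervalIntegral.integral_of_le zero_le_one, setIntegral_congr_fun measurableSet_Ioc h3,
    ← intervalIntegral.integral_of_le zero_le_one,
    intervalIntegral.integral_comp_sub_left (fun u => x * cos (x * u) * fourierWeight u) 1,
    sub_self, sub_zero, ← intervalIntegral.integral_const_mul]
  simp only [mul_assoc]

theorem tripleIntegral_eq {t : ℝ} (ht : 0 < t) :
    tripleIntegral t = ∫ x in (0 : ℝ)..1, fourierWeight x * (sin (t * x) / x) := by
  have h1 : ∀ x ∈ Ioc (0 : ℝ) t, (1 / x) * ∫ y in (0 : ℝ)..x, (1 / y) *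
      ∫ z in (0 : ℝ)..y, (1 / z) * tripleKernel x y z =
      ∫ u in (0 : ℝ)..1, cos (x * u) * fourierWeight u := fun x hx => by
    rw [tripleKernel_integral_yz hx.1, ← mul_assoc, one_div_mul_cancel hx.1.ne', one_mul]
  rw [tripleIntegral, intervalIntegral.integral_of_le ht.le,
    setIntegral_congr_fun measurableSet_Ioc h1, ← intervalIntegral.integral_of_le ht.le,
    rectangle_fubini (C := 1) t intervalIntegrable_fourierWeight
      (c := fun x u => cos (x * u)) (by unfold Function.uncurry; fun_prop)
      (fun _ _ => abs_cos_le_one _),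
    intervalIntegral.integral_of_le zero_le_one, intervalIntegral.integral_of_le zero_le_one]
  refine setIntegral_congr_fun measurableSet_Ioc fun u hu => ?_
  rw [intervalIntegral.integral_comp_mul_right cos hu.1.ne', integral_cos, zero_mul, sin_zero,
    sub_zero, smul_eq_mul]
  ring

/-! ### The limit of the sine integral. -/

theorem tendsto_sine_transform_fourierWeight :
    Tendsto (fun t : ℝ => ∫ x in (0 : ℝ)..1, fourierWeight x * (sin (t * x) / x))
      atTop (𝓝 0) := by
  have hi : IntervalIntegrable (fun x => fourierWeight x / x) volume 0 1 := by
    rw [intervalIntegrable_iff_integrableOn_Ioc_of_le zero_le_one,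
      integrableOn_Ioc_iff_integrableOn_Ioo]
    exact integrableOn_fourierWeight_div
  refine (tendsto_integral_mul_sin hi).congr fun t => ?_
  simp only [div_mul_eq_mul_div, mul_div_assoc]

/-! ### Absolute convergence of the triple integral. -/

theorem abs_tripleKernel_le (x y : ℝ) {z : ℝ} (hz : 0 ≤ z) : |tripleKernel x y z| ≤ 2 * z := by
  have hs : ∀ a b : ℝ, |sin a - sin b| ≤ |a - b| := fun a b => by
    simpa [dist_eq] using lipschitzWith_sin.dist_le_mul a b
  have h1 := hs x (x - z)
  have h2 := hs (x - y) (x - y + z)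
  rw [show x - (x - z) = z by ring, abs_of_nonneg hz] at h1
  rw [show x - y - (x - y + z) = -z by ring, abs_neg, abs_of_nonneg hz] at h2
  have h3 : tripleKernel x y z = (sin x - sin (x - z)) + (sin (x - y) - sin (x - y + z)) := by
    rw [tripleKernel]; ring
  rw [h3]
  linarith [abs_add_le (sin x - sin (x - z)) (sin (x - y) - sin (x - y + z))]

/-- The bound `2 z` on the kernel cancels `1/z` and leaves `1/(x y)`. As `z` is the smallest
variable, a power `1/3` can be moved from each of `x` and `y` onto `z`; every variable then carries
the integrable power `-2/3`. -/
theorem inv_mul_inv_le_rpow {x y z : ℝ} (hz : 0 < z) (hzy : z ≤ y) (hzx : z ≤ x) :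
    x⁻¹ * y⁻¹ ≤ x ^ (-(2 / 3) : ℝ) * (y ^ (-(2 / 3) : ℝ) * z ^ (-(2 / 3) : ℝ)) := by
  have hy := hz.trans_le hzy
  have hx := hz.trans_le hzx
  have hx1 : x⁻¹ = x ^ (-(2 / 3) : ℝ) * x ^ (-(1 / 3) : ℝ) := by
    rw [← rpow_add hx, ← rpow_neg_one]; norm_num
  have hy1 : y⁻¹ = y ^ (-(2 / 3) : ℝ) * y ^ (-(1 / 3) : ℝ) := by
    rw [← rpow_add hy, ← rpow_neg_one]; norm_num
  have hz1 : z ^ (-(2 / 3) : ℝ) = z ^ (-(1 / 3) : ℝ) * z ^ (-(1 / 3) : ℝ) := by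
    rw [← rpow_add hz]; norm_num
  have hxz : x ^ (-(1 / 3) : ℝ) ≤ z ^ (-(1 / 3) : ℝ) :=
    rpow_le_rpow_of_nonpos hz hzx (by norm_num)
  have hyz : y ^ (-(1 / 3) : ℝ) ≤ z ^ (-(1 / 3) : ℝ) :=
    rpow_le_rpow_of_nonpos hz hzy (by norm_num)
  rw [hx1, hy1, hz1, mul_mul_mul_comm, ← mul_assoc (x ^ _) (y ^ _)]
  gcongr

theorem integrableOn_tripleKernel (t : ℝ) :
    IntegrableOn
      (fun p : ℝ × ℝ × ℝ => tripleKernel p.1 p.2.1 p.2.2 / (p.1 * p.2.1 * p.2.2))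
      {p : ℝ × ℝ × ℝ | 0 < p.2.2 ∧ p.2.2 < p.2.1 ∧ p.2.1 < p.1 ∧ p.1 < t} volume := by
  set S := {p : ℝ × ℝ × ℝ | 0 < p.2.2 ∧ p.2.2 < p.2.1 ∧ p.2.1 < p.1 ∧ p.1 < t} with hS
  have hSm : MeasurableSet S := by
    simp only [hS, ofPred_and]
    refine MeasurableSet.inter ?_ (.inter ?_ (.inter ?_ ?_)) <;>
    exact measurableSet_lt (by fun_prop) (by fun_prop)
  -- Using `|t|` covers every real `t`; the region is empty when `t ≤ 0`.
  have hp : IntegrableOn (fun x : ℝ => x ^ (-(2 / 3) : ℝ)) (Ioc 0 |t|) := by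
    rw [← intervalIntegrable_iff_integrableOn_Ioc_of_le (abs_nonneg t)]
    exact intervalIntegral.intervalIntegrable_rpow' (by norm_num)
  have hprod : IntegrableOn (fun p : ℝ × ℝ × ℝ =>
      p.1 ^ (-(2 / 3) : ℝ) * (p.2.1 ^ (-(2 / 3) : ℝ) * p.2.2 ^ (-(2 / 3) : ℝ)))
      (Ioc 0 |t| ×ˢ (Ioc 0 |t| ×ˢ Ioc 0 |t|)) volume := by
    rw [IntegrableOn, Measure.volume_eq_prod, Measure.volume_eq_prod, ← Measure.prod_restrict,
      ← Measure.prod_restrict]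
    exact Integrable.mul_prod hp (Integrable.mul_prod hp hp)
  have hsub : S ⊆ Ioc 0 |t| ×ˢ (Ioc 0 |t| ×ˢ Ioc 0 |t|) := by
    rintro ⟨x, y, z⟩ ⟨hz, hzy, hyx, hxt⟩
    simp only at hz hzy hyx hxt
    have := le_abs_self t
    refine ⟨⟨?_, ?_⟩, ⟨?_, ?_⟩, ⟨?_, ?_⟩⟩ <;> simp only <;> linarith
  refine ((hprod.mono_set hsub).const_mul 2).mono' ?_ ?_
  · unfold tripleKernel
    exact Measurable.aestronglyMeasurable (by fun_prop)
  · filter_upwards [ae_restrict_mem hSm] with ⟨x, y, z⟩ ⟨hz, hzy, hyx, _⟩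
    simp only at hz hzy hyx ⊢
    have hy := hz.trans hzy
    have hx := hy.trans hyx
    have h1 := inv_mul_inv_le_rpow hz hzy.le (hzy.trans hyx).le
    refine le_trans ?_ (mul_le_mul_of_nonneg_left h1 zero_le_two)
    rw [Real.norm_eq_abs, abs_div, abs_of_pos (by positivity : 0 < x * y * z),
      div_le_iff₀ (by positivity)]
    refine (abs_tripleKernel_le x y hz.le).trans (le_of_eq ?_)
    field_simp

theorem mainTheorem1 :
    -- absolute convergence of the triple integral
    (∀ t : ℝ, 0 < t →
      IntegrableOn
        (fun p : ℝ × ℝ × ℝ => tripleKernel p.1 p.2.1 p.2.2 / (p.1 * p.2.1 * p.2.2))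
        {p : ℝ × ℝ × ℝ | 0 < p.2.2 ∧ p.2.2 < p.2.1 ∧ p.2.1 < p.1 ∧ p.1 < t} volume) ∧
    -- the Fourier sine integral is that of an integrable function
    (∀ x ∈ Icc (0 : ℝ) 1, Summable (seriesTerm x)) ∧
    IntegrableOn (fun x : ℝ => fourierWeight x / x) (Ioo 0 1) volume ∧
    (∀ t : ℝ, 0 < t →
      tripleIntegral t = ∫ x in (0 : ℝ)..1, fourierWeight x * (sin (t * x) / x)) ∧
    -- the two limits
    Tendsto tripleIntegral atTop (𝓝 0) ∧
    Tendsto (fun t : ℝ => ∫ x in (0 : ℝ)..1, fourierWeight x * (sin (t * x) / x))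
      atTop (𝓝 0) ∧
    -- the conjectured value is not the limit
    ¬ Tendsto tripleIntegral atTop (𝓝 (-π ^ 3 / 12)) := by
  have hlim : Tendsto tripleIntegral atTop (𝓝 0) :=
    tendsto_sine_transform_fourierWeight.congr'
      ((eventually_gt_atTop 0).mono fun _ ht => (tripleIntegral_eq ht).symm)
  refine ⟨fun t _ => integrableOn_tripleKernel t, fun x hx => summable_seriesTerm hx,
    integrableOn_fourierWeight_div, fun t ht => tripleIntegral_eq ht, hlim,
    tendsto_sine_transform_fourierWeight, fun h => ?_⟩
  have h0 := tendsto_nhds_unique hlim h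
  have := pow_pos pi_pos 3
  linarith
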